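/- Let $G=(V,E)$ be a finite connected simple graph, let $d_v$ be the degree of $v$, and let $\tau(\cdot)$ denote the number of spanning trees of a (multi)graph. For $x,y\in V$ let $H(x,y)$ be the hitting time, i.e. the expected first time $n\ge 0$ at which the simple random walk on $G$ (which at each step moves from the present vertex $v$ to each of its neighbours with probability $1/d_v$) started at $x$ is at $y$. For a graph $K$, let $\mathscr P_K(x,u)$ be the set of simple paths (no repeated vertices) from $x$ to $u$ in $K$, where $\mathscr P_K(x,x)$ consists of the trivial path $\{x\}$ only. For a finite simple graph $K$ with vertex weights $w$, the invariant $R(K,w)$ is the number determined by $R(\emptyset,w)=1$ and, for every vertex $x$ of $K$, $$R(K,w)=w_x\,R(K-\{x\},w)-\sum_{y\sim x}\ \sum_{P\in\mathscr P_K(x,y)}R(K-\{P\},w),$$ where $K-\{P\}$ is obtained from $K$ by deleting the vertices of $P$, and $w$ is restricted to the remaining vertices. Write $d_G$ for the weight function $v\mapsto d_v$ (degrees in $G$). Theorem 2.7. For all $x,y\in V$, the hitting time $H(x,y)$ is finite and $$H(x,y)=\frac1{\tau(G)}\sum_{u\in V}d_u\sum_{\substack{P\in\mathscr P_G(x,u)\\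 y\notin P}}R(G-\{P,y\},d_G).$$ Moreover, for every $u\in V$ and every $P\in\mathscr P_G(x,u)$ with $y\notin P$, $$R(G-\{P,y\},d_G)=\tau(G/\{P,y\}),$$ where $G-\{P,y\}$ is obtained from $G$ by deleting $y$ and the vertices of $P$, and $G/\{P,y\}$ is the multigraph obtained from $G$ by contracting $y$ and the vertices of $P$ to a single vertex. -/

import Mathlib

open scoped ENNReal
open MeasureTheory ProbabilityTheory

/-! ### Spanning trees and contractions of multigraphs -/

/-- `T` is a spanning tree of the multigraph `H`: a spanning subgraph without loops and without
parallel edges (i.e. without cycles of length one or two) whose adjacency relation is a tree. -/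
def Graph.IsSpanningTree {α β : Type*} (T H : Graph α β) : Prop :=
  T.IsSpanningSubgraph H ∧ T.Simple ∧ T.toSimpleGraph.IsTree

/-- The number `τ(H)` of spanning trees of a multigraph `H`. -/
noncomputable def Graph.numSpanningTrees {α β : Type*} (H : Graph α β) : ℕ :=
  {T : Graph α β | T.IsSpanningTree H}.ncard

open Classical in
/-- The multigraph `H / S`: all vertices in `S` are identified to the single vertex `none`, every
other vertex `v` becomes `some v`. All edges are kept, so that parallel edges may arise, and edges
inside `S` become loops. -/
noncomputable def Graph.contract {α β : Type*} (H : Graph α β) (S : Set α) :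
    Graph (Option α) β :=
  H.map (fun v => if v ∈ S then none else some v)

namespace SimpleGraph

variable {V : Type*} [Fintype V] [DecidableEq V] (G : SimpleGraph V) [DecidableRel G.Adj]

/-! ### The simple random walk and its hitting times -/

/-- One step of the simple random walk: from `v` move to a uniformly chosen neighbour. (At an
isolated vertex there is nowhere to go and the walk stays put.) -/
noncomputable def walkStep (v : V) : PMF V :=
  if h : (G.neighborFinset v).Nonempty then PMF.uniformOfFinset (G.neighborFinset v) h
  else PMF.pure v

/-- The transition kernel of the simple random walk. -/
noncomputable def walkKernel [MeasurableSpace V] [DiscreteMeasurableSpace V] : Kernel V V where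
  toFun v := (G.walkStep v).toMeasure
  measurable' := Measurable.of_discrete

instance [MeasurableSpace V] [DiscreteMeasurableSpace V] : IsMarkovKernel G.walkKernel where
  isProbabilityMeasure v := inferInstanceAs (IsProbabilityMeasure (G.walkStep v).toMeasure)

/-- The law, on the space of trajectories `ℕ → V`, of the simple random walk started at `x`: the
step from time `n` to time `n + 1` depends only on the position at time `n`, through
`walkKernel`. -/
noncomputable def walkLaw [MeasurableSpace V] [DiscreteMeasurableSpace V] (x : V) :
    Measure (ℕ → V) :=
  Kernel.traj (X := fun _ => V)
    (fun n => G.walkKernel.comap (fun h : (i : Finset.Iic n) → V => h ⟨n, Finset.mem_Iic.2 le_rfl⟩)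
      (measurable_pi_apply _)) 0 (fun _ => x)

/-- The hitting time `H(x, y)`: the expectation of the first time `n ≥ 0` at which the simple
random walk started at `x` is at `y` (this first time being `∞` if `y` is never reached). -/
noncomputable def expectedHittingTime (x y : V) : ℝ≥0∞ :=
  letI : MeasurableSpace V := ⊤
  haveI : DiscreteMeasurableSpace V := ⟨fun _ => trivial⟩
  ∫⁻ ω : ℕ → V, ENat.toENNReal (hittingAfter (fun n (ω : ℕ → V) => ω n) {y} 0 ω) ∂(G.walkLaw x)

/-! ### The invariant `R` of vertex-weighted graphs -/

/-- The invariant `R(G[S], w)` of the subgraph of `G` induced on `S`, with the weights `w`. It is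
`1` for the empty graph, and for a vertex `x` of `G[S]`
`R(G[S], w) = w x * R(G[S] - {x}, w) - ∑_{y ∼ x} ∑_P R(G[S] - P, w)`,
where `y` runs over the neighbours of `x` in `G[S]` and `P` over the simple paths from `x` to `y` in
`G[S]`, i.e. those of `G` with all vertices in `S`. The recursion is run here with some choice of
`x`; `invR_eq` shows that it holds for every vertex `x` of `G[S]`. -/
noncomputable def invR (w : V → ℝ) (S : Finset V) : ℝ :=
  if h : S.Nonempty then
    w h.choose * invR w (S.erase h.choose) -
      ∑ y ∈ S with G.Adj h.choose y,
        ∑ P : G.Path h.choose y with P.1.support.toFinset ⊆ S, invR w (S \ P.1.support.toFinset)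
  else 1
termination_by S.card
decreasing_by
  · exact Finset.card_erase_lt_of_mem h.choose_spec
  · have h1 : h.choose ∈ S := h.choose_spec
    have h2 : h.choose ∉ S \ P.1.support.toFinset := by simp
    exact Finset.card_lt_card ⟨Finset.sdiff_subset, fun hs => h2 (hs h1)⟩

set_option linter.unusedSectionVars false

/-- Auxiliary matrix: `diag(w) - A` on `S × S`, extended by the identity. -/
noncomputable def auxMatrix (w : V → ℝ) (S : Finset V) : Matrix V V ℝ :=
  fun i j => if i ∈ S ∧ j ∈ S then (if i = j then w i else if G.Adj i j then -1 else 0)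
    else if i = j then 1 else 0

lemma auxMatrix_of_mem (w : V → ℝ) (S : Finset V) {i j : V} (hi : i ∈ S) (hij : i ≠ j) :
    G.auxMatrix w S i j = if j ∈ S ∧ G.Adj i j then -1 else 0 := by
  by_cases hj : j ∈ S <;> simp [auxMatrix, hi, hj, hij]

lemma auxMatrix_diag (w : V → ℝ) (S : Finset V) {i : V} (hi : i ∈ S) :
    G.auxMatrix w S i i = w i := by
  simp [auxMatrix, hi]

lemma auxMatrix_symm (w : V → ℝ) (S : Finset V) (i j : V) :
    G.auxMatrix w S i j = G.auxMatrix w S j i := by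
  unfold auxMatrix
  by_cases h : i = j
  · subst h; rfl
  · simp [h, Ne.symm h, and_comm, G.adj_comm]

/-- If the row `x` of a matrix is the unit vector `e_x`, the column `x` may be cleared. -/
lemma det_eq_det_updateCol {A : Matrix V V ℝ} {x : V} (h : A x = Pi.single x 1) :
    A.det = (A.updateCol x (Pi.single x 1)).det := by
  rw [Matrix.det_apply', Matrix.det_apply']
  refine Finset.sum_congr rfl fun σ _ => ?_
  congr 1
  by_cases hσ : σ x = x
  · refine Finset.prod_congr rfl fun i _ => ?_
    by_cases hi : i = x
    · subst hi; simp [hσ, h]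
    · simp [hi]
  · have h1 : σ⁻¹ x ≠ x := fun h => hσ (by rw [Equiv.Perm.inv_eq_iff_eq] at h; exact h.symm)
    have h2 : σ (σ⁻¹ x) = x := by simp
    rw [Finset.prod_eq_zero (Finset.mem_univ (σ⁻¹ x)), Finset.prod_eq_zero (Finset.mem_univ (σ⁻¹ x))]
    · rw [h2, Matrix.updateCol_ne h1, h, Pi.single_eq_of_ne h1]
    · rw [h2, h, Pi.single_eq_of_ne h1]

lemma auxMatrix_erase (w : V → ℝ) (S : Finset V) (x : V) :
    ((G.auxMatrix w S).updateRow x (Pi.single x 1)).updateCol x (Pi.single x 1) =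
      G.auxMatrix w (S.erase x) := by
  ext i j
  by_cases hi : i = x <;> by_cases hj : j = x <;>
    simp [Matrix.updateRow_apply, auxMatrix, hi, hj, eq_comm (a := x) (b := j)]

lemma adjugate_auxMatrix_self (w : V → ℝ) (S : Finset V) (x : V) :
    (G.auxMatrix w S).adjugate x x = (G.auxMatrix w (S.erase x)).det := by
  rw [Matrix.adjugate_apply, det_eq_det_updateCol (x := x) (by simp), auxMatrix_erase]

lemma adjugate_auxMatrix_of_ne (w : V → ℝ) (S : Finset V) {x y : V} (hx : x ∈ S) (hxy : x ≠ y) :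
    (G.auxMatrix w S).adjugate x y =
      ∑ z ∈ S.erase x with G.Adj x z, (G.auxMatrix w (S.erase x)).adjugate z y := by
  rw [Matrix.adjugate_apply,
    Matrix.det_eq_sum_mul_adjugate_row _ x, Finset.sum_filter]
  rw [← Finset.sum_subset (Finset.subset_univ (S.erase x))]
  · refine Finset.sum_congr rfl fun z hz => ?_
    have hzx : z ≠ x := Finset.ne_of_mem_erase hz
    have hzS : z ∈ S := Finset.mem_of_mem_erase hz
    rw [Matrix.updateRow_ne hxy, auxMatrix_of_mem G w S hx hzx.symm]
    by_cases hA : G.Adj x z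
    · rw [if_pos ⟨hzS, hA⟩, if_pos hA, Matrix.adjugate_apply, Matrix.adjugate_apply,
        ← auxMatrix_erase]
      have h1 : ((G.auxMatrix w S).updateRow y (Pi.single x 1)).updateRow x (Pi.single z 1) =
          (((G.auxMatrix w S).updateRow x (Pi.single x 1)).updateRow y (Pi.single z 1)).submatrix
            (Equiv.swap x y) id := by
        ext i j
        by_cases hi : i = x
        · subst hi; simp
        · by_cases hi' : i = y
          · subst hi'; simp [hi, Matrix.updateRow_apply, hxy]
          · simp [Matrix.updateRow_apply, hi, hi', Equiv.swap_apply_of_ne_of_ne hi hi']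
      have h2 : (((G.auxMatrix w S).updateRow x (Pi.single x 1)).updateCol x
          (Pi.single x 1)).updateRow y (Pi.single z 1) =
          (((G.auxMatrix w S).updateRow x (Pi.single x 1)).updateRow y
            (Pi.single z 1)).updateCol x (Pi.single x 1) := by
        ext i j
        by_cases hi : i = y <;> by_cases hj : j = x <;>
          simp [Matrix.updateRow_apply, hi, hj, Pi.single_apply, hzx.symm,
            hxy.symm]
      rw [h1, h2, Matrix.det_permute, Equiv.Perm.sign_swap hxy,
        ← det_eq_det_updateCol (x := x)]
      · simp
      · rw [Matrix.updateRow_ne hxy, Matrix.updateRow_self]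
    · simp [hA]
  · intro z _ hz
    by_cases hzx : z = x
    · subst hzx
      rw [Matrix.adjugate_apply, Matrix.det_zero_of_row_eq hxy, mul_zero]
      rw [Matrix.updateRow_self, Matrix.updateRow_ne hxy.symm, Matrix.updateRow_self]
    · rw [Matrix.updateRow_ne hxy, auxMatrix_of_mem G w S hx (Ne.symm hzx), if_neg, zero_mul]
      exact fun h => hz (Finset.mem_erase.2 ⟨hzx, h.1⟩)

/-- Splitting off the first edge of a simple path. -/
lemma sum_path_eq (f : Finset V → ℝ) (S : Finset V) {x y : V} (hx : x ∈ S) (hxy : x ≠ y) :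
    ∑ P : G.Path x y with P.1.support.toFinset ⊆ S, f (S \ P.1.support.toFinset) =
      ∑ z ∈ S.erase x with G.Adj x z, ∑ P : G.Path z y with P.1.support.toFinset ⊆ S.erase x,
        f (S.erase x \ P.1.support.toFinset) := by
  rw [Finset.sum_sigma']
  symm
  refine Finset.sum_bij (fun a ha => ⟨Walk.cons (by simp at ha; exact ha.1.2) a.2.1, ?_⟩) ?_ ?_ ?_ ?_
  · simp only [Finset.mem_sigma, Finset.mem_filter, Finset.mem_univ, true_and] at ha
    rw [Walk.cons_isPath_iff]
    refine ⟨a.2.2, fun h => ?_⟩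
    exact Finset.notMem_erase x S (ha.2 (List.mem_toFinset.2 h))
  · intro a ha
    simp only [Finset.mem_sigma, Finset.mem_filter, Finset.mem_univ, true_and] at ha ⊢
    rw [Walk.support_cons, List.toFinset_cons]
    exact Finset.insert_subset hx (ha.2.trans (Finset.erase_subset _ _))
  · rintro ⟨z, P, hP⟩ ha ⟨z', P', hP'⟩ ha' h
    simp only [Subtype.mk.injEq, Walk.cons.injEq] at h
    obtain ⟨rfl, h⟩ := h
    simp only [heq_eq_eq] at h
    subst h
    rfl
  · rintro ⟨P, hP⟩ hb
    cases P with
    | nil => exact absurd rfl hxy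
    | @cons _ z _ hA Q =>
      rw [Walk.cons_isPath_iff] at hP
      simp only [Finset.mem_filter, Finset.mem_univ, true_and, Walk.support_cons,
        List.toFinset_cons] at hb
      have h1 : Q.support.toFinset ⊆ S.erase x := fun v hv => Finset.mem_erase.2
        ⟨fun h => hP.2 (h ▸ List.mem_toFinset.1 hv), hb (Finset.mem_insert_of_mem hv)⟩
      refine ⟨⟨z, ⟨Q, hP.1⟩⟩, ?_, rfl⟩
      simp only [Finset.mem_sigma, Finset.mem_filter, Finset.mem_univ, true_and]
      exact ⟨⟨h1 (List.mem_toFinset.2 Q.start_mem_support), hA⟩, h1⟩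
  · intro a ha
    congr 1
    ext v
    simp only [Walk.support_cons, List.toFinset_cons, Finset.mem_sdiff, Finset.mem_erase,
      Finset.mem_insert]
    tauto

lemma adjugate_auxMatrix (w : V → ℝ) (y : V) (n : ℕ) : ∀ (S : Finset V), S.card = n → ∀ x ∈ S,
    y ∈ S → (G.auxMatrix w S).adjugate x y =
      ∑ P : G.Path x y with P.1.support.toFinset ⊆ S,
        (G.auxMatrix w (S \ P.1.support.toFinset)).det := by
  induction n with
  | zero => intro S hS x hx; simp [Finset.card_eq_zero.1 hS] at hx
  | succ n ih =>
    intro S hS x hx hy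
    by_cases hxy : x = y
    · subst hxy
      rw [adjugate_auxMatrix_self, Finset.sum_eq_single Path.nil]
      · simp [Finset.sdiff_singleton_eq_erase]
      · intro P _ hP
        exact absurd (Path.loop_eq P) hP
      · intro h
        simp [hx] at h
    · rw [adjugate_auxMatrix_of_ne G w S hx hxy,
        sum_path_eq G (fun S => (G.auxMatrix w S).det) S hx hxy]
      refine Finset.sum_congr rfl fun z hz => ?_
      exact ih _ (by rw [Finset.card_erase_of_mem hx, hS]; rfl) z (Finset.mem_filter.1 hz).1
        (Finset.mem_erase.2 ⟨Ne.symm hxy, hy⟩)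

lemma det_auxMatrix (w : V → ℝ) (S : Finset V) {x : V} (hx : x ∈ S) :
    (G.auxMatrix w S).det = w x * (G.auxMatrix w (S.erase x)).det -
      ∑ y ∈ S with G.Adj x y, ∑ P : G.Path x y with P.1.support.toFinset ⊆ S,
        (G.auxMatrix w (S \ P.1.support.toFinset)).det := by
  rw [Matrix.det_eq_sum_mul_adjugate_col _ x, ← Finset.add_sum_erase _ _ (Finset.mem_univ x),
    auxMatrix_diag G w S hx, adjugate_auxMatrix_self, sub_eq_add_neg]
  congr 1
  rw [← Finset.sum_neg_distrib]
  symm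
  have hsub : {y ∈ S | G.Adj x y} ⊆ Finset.univ.erase x := fun y hy =>
    Finset.mem_erase.2 ⟨(Finset.mem_filter.1 hy).2.ne', Finset.mem_univ y⟩
  rw [← Finset.sum_subset hsub]
  · refine Finset.sum_congr rfl fun y hy => ?_
    rw [Finset.mem_filter] at hy
    rw [auxMatrix_symm, auxMatrix_of_mem G w S hx hy.2.ne, if_pos hy,
      adjugate_auxMatrix G w y _ S rfl x hx hy.1]
    ring
  · intro y hy hy'
    rw [auxMatrix_symm, auxMatrix_of_mem G w S hx (Finset.ne_of_mem_erase hy).symm, if_neg, zero_mul]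
    exact fun h => hy' (Finset.mem_filter.2 h)

/-- The invariant `R(G[S], w)` does not depend on the choices in its definition: it is the
determinant of `diag(w) - A` restricted to `S`. -/
lemma invR_eq_det (w : V → ℝ) (n : ℕ) : ∀ (S : Finset V), S.card = n →
    G.invR w S = (G.auxMatrix w S).det := by
  induction n using Nat.strong_induction_on with
  | _ n ih =>
    intro S hS
    rw [invR]
    by_cases h : S.Nonempty
    · rw [dif_pos h, det_auxMatrix G w S h.choose_spec]
      congr 1
      · rw [ih _ (hS ▸ Finset.card_erase_lt_of_mem h.choose_spec) _ rfl]
      · refine Finset.sum_congr rfl fun y _ => Finset.sum_congr rfl fun P _ => ?_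
        refine ih _ ?_ _ rfl
        have h1 : h.choose ∈ S := h.choose_spec
        have h2 : h.choose ∉ S \ P.1.support.toFinset := by simp
        exact hS ▸ Finset.card_lt_card ⟨Finset.sdiff_subset, fun hs => h2 (hs h1)⟩
    · rw [dif_neg h, Finset.not_nonempty_iff_eq_empty.1 h]
      have : G.auxMatrix w ∅ = 1 := by
        ext i j; simp [auxMatrix, Matrix.one_apply]
      rw [this, Matrix.det_one]

lemma invR_empty (w : V → ℝ) : G.invR w ∅ = 1 := by
  rw [invR, dif_neg Finset.not_nonempty_empty]

/-- The defining recursion of `R(G[S], w)` holds for every vertex `x` of `G[S]`. -/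
lemma invR_eq (w : V → ℝ) (S : Finset V) {x : V} (hx : x ∈ S) :
    G.invR w S = w x * G.invR w (S.erase x) -
      ∑ y ∈ S with G.Adj x y, ∑ P : G.Path x y with P.1.support.toFinset ⊆ S,
        G.invR w (S \ P.1.support.toFinset) := by
  simp only [invR_eq_det G w _ _ rfl]
  exact det_auxMatrix G w S hx

end SimpleGraph

/-! ### Rooted spanning forests and the matrix tree theorem for principal minors -/

namespace SimpleGraph
variable {V : Type*} [Fintype V] [DecidableEq V]

/-! The hitting times of `y` satisfy the first-step equations: `h y = 0`, and `d_v h(v) = d_v + ∑_{z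
∼ v} h(z)` for `v ≠ y`. This is a linear system `M h = b`, where `M` is the Laplacian with the row
and column of `y` replaced by those of the identity (`auxMatrix_mulVec_eq_iff`). Hence `h = adj(M) b
/ det M`. By the matrix tree theorem (`det_auxMatrix_degree`, `numSpanningTrees_ofSimpleGraph`),
`det M = τ(G)`, which is positive. The entry `adj(M) x u` is a sum over simple paths `P` from `x` to
`u` avoiding `y` of the principal minors on the vertices outside `P` and `y` (`adjugate_auxMatrix`),
and these minors are the values of `R` (`invR_eq_det`). This gives the formula.

Every principal minor on a set `U` counts forests rooted outside `U`. Gluing the roots together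
turns such forests into spanning trees of the contracted multigraph (`numSpanningTrees_contract`),
which identifies `R` with `τ(G/{P,y})`.

Finiteness needs an argument before the system can be solved over the reals: the adjugate solution
is nonnegative, because its entries count forests, and any nonnegative solution bounds the hitting
times (`expectedHittingTime_le`). -/

open Classical in
/-- The spanning forests of `G` rooted at the complement of `U`: edge sets with `#U` elements
through which every vertex is joined to a vertex outside `U`. -/
noncomputable def rootedForests (G : SimpleGraph V) (U : Finset V) : Finset (Finset (Sym2 V)) :=
  {F ∈ G.edgeFinset.powerset | F.card = U.card ∧
    ∀ v, ∃ s, s ∉ U ∧ (fromEdgeSet (F : Set (Sym2 V))).Reachable v s}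

lemma mem_rootedForests {G : SimpleGraph V} {U : Finset V} {F : Finset (Sym2 V)} :
    F ∈ G.rootedForests U ↔ (F : Set (Sym2 V)) ⊆ G.edgeSet ∧ F.card = U.card ∧
      ∀ v, ∃ s, s ∉ U ∧ (fromEdgeSet (F : Set (Sym2 V))).Reachable v s := by
  classical
  simp [rootedForests, Finset.subset_iff, Set.subset_def]

lemma rootedForests_empty (G : SimpleGraph V) : G.rootedForests ∅ = {∅} := by
  ext F
  rw [mem_rootedForests, Finset.mem_singleton]
  constructor
  · rintro ⟨-, h, -⟩
    simpa using h
  · rintro rfl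
    exact ⟨by simp, rfl, fun v => ⟨v, by simp, Reachable.rfl⟩⟩

/-- No edge of `G` leaves `U`, so a vertex of `U` can never reach a root. -/
lemma rootedForests_eq_empty {G : SimpleGraph V} {U : Finset V} (hU : U.Nonempty)
    (h : ∀ u ∈ U, ∀ v, G.Adj u v → v ∈ U) : G.rootedForests U = ∅ := by
  refine Finset.eq_empty_of_forall_notMem fun F hF => ?_
  rw [mem_rootedForests] at hF
  obtain ⟨u, hu⟩ := hU
  obtain ⟨s, hs, ⟨p⟩⟩ := hF.2.2 u
  induction p with
  | nil => exact hs hu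
  | cons hA _ ih => exact ih (h _ hu _ (hF.1 ((fromEdgeSet_adj _).1 hA).1)) hs

omit [Fintype V] in
/-- A forest rooted outside `U` which contains the edge `uv`, with `u ∈ U` and `v ∉ U`, is a forest
rooted outside `U \ {u}` together with that edge. -/
lemma rooted_insert_iff {F : Finset (Sym2 V)} {U : Finset V} {u v : V} (hu : u ∈ U) (hv : v ∉ U) :
    (∀ w, ∃ s, s ∉ U ∧
      (fromEdgeSet ((insert s(u, v) F : Finset (Sym2 V)) : Set (Sym2 V))).Reachable w s) ↔
    ∀ w, ∃ s, s ∉ U.erase u ∧ (fromEdgeSet (F : Set (Sym2 V))).Reachable w s := by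
  have huv : u ≠ v := fun h => hv (h ▸ hu)
  constructor
  · intro h w
    obtain ⟨s, hs, ⟨p⟩⟩ := h w
    induction p with
    | nil => exact ⟨_, fun h => hs (Finset.mem_of_mem_erase h), Reachable.rfl⟩
    | @cons a b _ hA _ ih =>
      rw [fromEdgeSet_adj, Finset.coe_insert, Set.mem_insert_iff] at hA
      obtain ⟨h1 | h1, h2⟩ := hA
      · refine ⟨a, ?_, Reachable.rfl⟩
        rw [Sym2.eq_iff] at h1
        rcases h1 with ⟨rfl, rfl⟩ | ⟨rfl, rfl⟩
        · simp
        · exact fun h => hv (Finset.mem_of_mem_erase h)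
      · obtain ⟨s', hs', hr⟩ := ih hs
        exact ⟨s', hs', (Adj.reachable ((fromEdgeSet_adj _).2 ⟨h1, h2⟩)).trans hr⟩
  · intro h w
    obtain ⟨s, hs, hr⟩ := h w
    have hr' := hr.mono (fromEdgeSet_mono (Finset.coe_subset.2 (Finset.subset_insert s(u, v) F)))
    by_cases hsu : s = u
    · subst hsu
      refine ⟨v, hv, hr'.trans (Adj.reachable ((fromEdgeSet_adj _).2 ⟨?_, huv⟩))⟩
      simp
    · exact ⟨s, fun h => hs (Finset.mem_erase.2 ⟨hsu, h⟩), hr'⟩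

/-- Deletion–contraction along an edge joining `u` to a root: a forest either avoids `uv`, or
removing `uv` turns `u` itself into a root. -/
lemma card_rootedForests {G : SimpleGraph V} {U : Finset V} {u v : V} (hu : u ∈ U) (hv : v ∉ U)
    (hA : G.Adj u v) :
    (G.rootedForests U).card = ((G.deleteEdges {s(u, v)}).rootedForests U).card +
      ((G.deleteEdges {s(u, v)}).rootedForests (U.erase u)).card := by
  classical
  have hcard := Finset.card_erase_add_one hu
  rw [← Finset.card_filter_add_card_filter_not (s := G.rootedForests U) (fun F => s(u, v) ∉ F)]
  congr 1
  · congr 1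
    ext F
    rw [Finset.mem_filter, mem_rootedForests, mem_rootedForests, edgeSet_deleteEdges,
      Set.subset_sdiff, Set.disjoint_singleton_right, Finset.mem_coe]
    tauto
  · refine Finset.card_bij (fun F _ => F.erase s(u, v)) ?_ ?_ ?_
    · intro F hF
      rw [Finset.mem_filter, mem_rootedForests, not_not] at hF
      obtain ⟨⟨h1, h2, h3⟩, h4⟩ := hF
      rw [mem_rootedForests, edgeSet_deleteEdges, ← rooted_insert_iff hu hv,
        Finset.insert_erase h4]
      refine ⟨?_, ?_, h3⟩
      · rw [Finset.coe_erase]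
        exact Set.sdiff_subset_sdiff_left h1
      · have := Finset.card_erase_add_one h4
        omega
    · intro F hF F' hF' h
      rw [Finset.mem_filter, not_not] at hF hF'
      rw [← Finset.insert_erase hF.2, h, Finset.insert_erase hF'.2]
    · intro F hF
      rw [mem_rootedForests, edgeSet_deleteEdges, Set.subset_sdiff, Set.disjoint_singleton_right,
        Finset.mem_coe] at hF
      obtain ⟨⟨h1, h1'⟩, h2, h3⟩ := hF
      refine ⟨insert s(u, v) F, ?_, Finset.erase_insert h1'⟩
      rw [Finset.mem_filter, mem_rootedForests, rooted_insert_iff hu hv, not_not,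
        Finset.card_insert_of_notMem h1', h2]
      refine ⟨⟨?_, hcard, h3⟩, Finset.mem_insert_self _ _⟩
      rw [Finset.coe_insert]
      exact Set.insert_subset hA h1

/-- Since `v ∉ U`, deleting `uv` changes a single entry on `U × U`: the degree of `u` drops by one.
The form as a row sum prepares for linearity of the determinant in row `u`. -/
lemma auxMatrix_degree_eq_updateRow (G : SimpleGraph V) [DecidableRel G.Adj]
    {U : Finset V} {u v : V} [DecidableRel (G.deleteEdges {s(u, v)}).Adj]
    (hu : u ∈ U) (hv : v ∉ U) (hA : G.Adj u v) :
    G.auxMatrix (fun i => (G.degree i : ℝ)) U =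
      ((G.deleteEdges {s(u, v)}).auxMatrix
        (fun i => ((G.deleteEdges {s(u, v)}).degree i : ℝ)) U).updateRow u
      ((G.deleteEdges {s(u, v)}).auxMatrix
        (fun i => ((G.deleteEdges {s(u, v)}).degree i : ℝ)) U u + Pi.single u 1) := by
  have hdu : G.degree u = (G.deleteEdges {s(u, v)}).degree u + 1 := by
    rw [← card_neighborFinset_eq_degree, ← card_neighborFinset_eq_degree,
      ← Finset.card_erase_add_one ((G.mem_neighborFinset u v).2 hA)]
    congr 2
    ext w
    simp only [Finset.mem_erase, mem_neighborFinset, deleteEdges_adj, Set.mem_singleton_iff]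
    rw [Sym2.congr_right, and_comm]
  have hd : ∀ i ∈ U, i ≠ u → G.degree i = (G.deleteEdges {s(u, v)}).degree i := by
    intro i hi hiu
    have hiv : i ≠ v := fun h => hv (h ▸ hi)
    rw [← card_neighborFinset_eq_degree, ← card_neighborFinset_eq_degree]
    congr 1
    ext w
    simp [deleteEdges_adj, hiu, hiv]
  have hadj : ∀ i ∈ U, ∀ j ∈ U, ((G.deleteEdges {s(u, v)}).Adj i j ↔ G.Adj i j) := by
    intro i hi j hj
    have hiv : i ≠ v := fun h => hv (h ▸ hi)
    have hjv : j ≠ v := fun h => hv (h ▸ hj)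
    simp [deleteEdges_adj, hiv, hjv]
  ext i j
  by_cases hiu : i = u
  · subst hiu
    rw [Matrix.updateRow_self, Pi.add_apply]
    by_cases hij : i = j
    · subst hij
      rw [auxMatrix_diag _ _ _ hu, auxMatrix_diag _ _ _ hu, hdu]
      simp
    · rw [auxMatrix_of_mem _ _ _ hu hij, auxMatrix_of_mem _ _ _ hu hij,
        Pi.single_eq_of_ne (Ne.symm hij), add_zero]
      by_cases hj : j ∈ U
      · simp only [hadj i hu j hj]
      · simp [hj]
  · rw [Matrix.updateRow_ne hiu]
    unfold auxMatrix
    by_cases hij : i ∈ U ∧ j ∈ U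
    · simp only [hij, hd i hij.1 hiu, hadj i hij.1 j hij.2]
    · rw [if_neg hij, if_neg hij]

/-- When no edge leaves `U`, the Laplacian rows of `U` sum to zero within `U`, so the indicator of
`U` is a nonzero kernel vector. -/
lemma det_auxMatrix_degree_eq_zero (G : SimpleGraph V) [DecidableRel G.Adj] {U : Finset V}
    (hU : U.Nonempty) (h : ∀ u ∈ U, ∀ v, G.Adj u v → v ∈ U) :
    (G.auxMatrix (fun i => (G.degree i : ℝ)) U).det = 0 := by
  rw [← Matrix.exists_mulVec_eq_zero_iff]
  refine ⟨fun i => if i ∈ U then 1 else 0, fun h0 => ?_, ?_⟩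
  · obtain ⟨u, hu⟩ := hU
    simpa [hu] using congrFun h0 u
  · ext i
    rw [Matrix.mulVec, dotProduct, Pi.zero_apply]
    simp only [mul_ite, mul_one, mul_zero]
    by_cases hi : i ∈ U
    · rw [← Finset.add_sum_erase _ _ (Finset.mem_univ i), if_pos hi, auxMatrix_diag _ _ _ hi,
        ← card_neighborFinset_eq_degree, Finset.card_eq_sum_ones, Nat.cast_sum,
        neighborFinset_eq_filter, Finset.sum_filter, ← Finset.add_sum_erase _ _ (Finset.mem_univ i)]
      simp only [SimpleGraph.irrefl, if_false, zero_add]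
      rw [← Finset.sum_add_distrib]
      refine Finset.sum_eq_zero fun j hj => ?_
      rw [auxMatrix_of_mem _ _ _ hi (Finset.ne_of_mem_erase hj).symm]
      by_cases hA : G.Adj i j
      · simp [hA, h i hi j hA]
      · simp [hA]
    · refine Finset.sum_eq_zero fun j _ => ?_
      by_cases hj : j ∈ U
      · have : i ≠ j := fun h => hi (h ▸ hj)
        simp [auxMatrix, hi, this]
      · simp [hj]

/-- The matrix tree theorem for principal minors: a principal minor of the Laplacian
counts rooted spanning forests. -/
theorem det_auxMatrix_degree (n : ℕ) : ∀ (G : SimpleGraph V) [DecidableRel G.Adj] (U : Finset V),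
    G.edgeFinset.card + U.card = n →
    (G.auxMatrix (fun i => (G.degree i : ℝ)) U).det = ((G.rootedForests U).card : ℝ) := by
  classical
  induction n using Nat.strong_induction_on with
  | _ n ih =>
    intro G _ U hn
    rcases U.eq_empty_or_nonempty with rfl | hU
    · have : G.auxMatrix (fun i => (G.degree i : ℝ)) ∅ = 1 := by
        ext i j; simp [auxMatrix, Matrix.one_apply]
      rw [this, rootedForests_empty]
      simp
    by_cases h : ∀ u ∈ U, ∀ v, G.Adj u v → v ∈ U
    · rw [det_auxMatrix_degree_eq_zero G hU h, rootedForests_eq_empty hU h]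
      simp
    push Not at h
    obtain ⟨u, hu, v, hA, hv⟩ := h
    have hlt : (G.deleteEdges {s(u, v)}).edgeFinset.card < G.edgeFinset.card := by
      refine Finset.card_lt_card (edgeFinset_strict_mono (lt_of_le_of_ne (deleteEdges_le _) ?_))
      intro h
      have := hA
      rw [← h] at this
      simp at this
    have hcard := Finset.card_erase_add_one hu
    -- The summand with row `e_u` is a diagonal cofactor, that is, the minor on `U.erase u` of the
    -- graph without `uv`. The two minors obey the same recursion as the forest counts.
    rw [auxMatrix_degree_eq_updateRow G hu hv hA, Matrix.det_updateRow_add,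
      Matrix.updateRow_eq_self, ← Matrix.adjugate_apply, adjugate_auxMatrix_self,
      ih _ (by omega) _ U rfl, ih _ (by omega) _ (U.erase u) rfl, card_rootedForests hu hv hA,
      Nat.cast_add]

end SimpleGraph

/-! ### Spanning trees of a multigraph with identified vertices -/

namespace SimpleGraph
variable {V : Type*} [Fintype V] [DecidableEq V] {α : Type*}

omit [Fintype V] [DecidableEq V] in
lemma map_restrict_isLink {G : SimpleGraph V} {f : V → α} {F : Set (Sym2 V)}
    (hF : F ⊆ G.edgeSet) {e : Sym2 V} {a b : α} :
    (((Graph.ofSimpleGraph G).map f).restrict F).IsLink e a b ↔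
      e ∈ F ∧ ∃ p q, e = s(p, q) ∧ f p = a ∧ f q = b := by
  rw [Graph.restrict_isLink, Graph.map_isLink, Relation.Map]
  simp only [Graph.ofSimpleGraph_isLink]
  constructor
  · rintro ⟨h, p, q, ⟨h1, -⟩, h2⟩
    exact ⟨h, p, q, h1, h2⟩
  · rintro ⟨h, p, q, h1, h2⟩
    exact ⟨h, p, q, ⟨h1, hF h⟩, h2⟩

-- Here `f` collapses the complement of `U` to the point `f y` and has singleton fibres over `U`. A
-- walk to `f y` in the quotient therefore lifts edge by edge for as long as it stays over `U`, and
-- the lift ends at a root. Conversely, walks project, with edges inside a fibre becoming trivial.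
omit [Fintype V] in
lemma map_restrict_connected_iff {G : SimpleGraph V} {f : V → α} {U : Finset V} {y : V}
    (hU : ∀ u ∈ U, ∀ v, f v = f u → v = u) (hy : y ∉ U) (hUc : ∀ v, v ∉ U → f v = f y)
    {F : Set (Sym2 V)} (hF : F ⊆ G.edgeSet) :
    (((Graph.ofSimpleGraph G).map f).restrict F).toSimpleGraph.Connected ↔
      ∀ v, ∃ s, s ∉ U ∧ (fromEdgeSet F).Reachable v s := by
  set T := ((Graph.ofSimpleGraph G).map f).restrict F
  have hlk : ∀ {e a b}, T.IsLink e a b ↔ e ∈ F ∧ ∃ p q, e = s(p, q) ∧ f p = a ∧ f q = b :=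
    map_restrict_isLink hF
  have hmem : ∀ v, f v ∈ T.vertexSet := fun v => ⟨v, trivial, rfl⟩
  constructor
  · intro h v
    obtain ⟨p⟩ := h.preconnected ⟨f v, hmem v⟩ ⟨f y, hmem y⟩
    have key : ∀ (a b : T.vertexSet) (_ : T.toSimpleGraph.Walk a b), b.1 = f y → ∀ w, f w = a.1 →
        ∃ s, s ∉ U ∧ (fromEdgeSet F).Reachable w s := by
      intro a b p
      induction p with
      | nil =>
        intro hb w hw
        exact ⟨w, fun hwU => hy (hU w hwU y (hb ▸ hw).symm ▸ hwU), Reachable.rfl⟩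
      | @cons a b _ hA _ ih =>
        intro hb w hw
        by_cases hwU : w ∈ U
        · obtain ⟨hne, e, he⟩ := hA
          rw [hlk] at he
          obtain ⟨he, p, q, rfl, hp, hq⟩ := he
          obtain rfl := hU w hwU p (hp.trans hw.symm)
          obtain ⟨s, hs, hr⟩ := ih hb q hq
          refine ⟨s, hs, (Adj.reachable ((fromEdgeSet_adj _).2 ⟨he, ?_⟩)).trans hr⟩
          rintro rfl
          exact hne (Subtype.ext (hp.symm.trans hq))
        · exact ⟨w, hwU, Reachable.rfl⟩
    exact key _ _ p rfl v rfl
  · intro h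
    have key : ∀ v s, (fromEdgeSet F).Reachable v s →
        T.toSimpleGraph.Reachable ⟨f v, hmem v⟩ ⟨f s, hmem s⟩ := by
      rintro v s ⟨p⟩
      induction p with
      | nil => exact Reachable.rfl
      | @cons a b _ hA _ ih =>
        refine Reachable.trans ?_ ih
        by_cases hab : f a = f b
        · have : (⟨f a, hmem a⟩ : T.vertexSet) = ⟨f b, hmem b⟩ := Subtype.ext hab
          rw [this]
        · refine Adj.reachable ⟨fun h => hab (congrArg Subtype.val h), s(a, b), ?_⟩
          rw [hlk]
          exact ⟨((fromEdgeSet_adj _).1 hA).1, a, b, rfl, rfl, rfl⟩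
    have key' : ∀ a : T.vertexSet, T.toSimpleGraph.Reachable a ⟨f y, hmem y⟩ := by
      rintro ⟨_, v, -, rfl⟩
      obtain ⟨s, hs, hr⟩ := h v
      have := key v s hr
      simp only [hUc s hs] at this
      exact this
    exact (connected_iff _).2 ⟨fun a b => (key' a).trans (key' b).symm, ⟨⟨f y, hmem y⟩⟩⟩

lemma card_map_vertexSet (G : SimpleGraph V) {f : V → α} {U : Finset V} {y : V}
    (hU : ∀ u ∈ U, ∀ v, f v = f u → v = u) (hy : y ∉ U) (hUc : ∀ v, v ∉ U → f v = f y) :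
    Nat.card ((Graph.ofSimpleGraph G).map f).vertexSet = U.card + 1 := by
  have : ((Graph.ofSimpleGraph G).map f).vertexSet = insert (f y) (f '' U) := by
    ext a
    simp only [Graph.vertexSet_map, Graph.vertexSet_ofSimpleGraph, Set.image_univ, Set.mem_range,
      Set.mem_insert_iff, Set.mem_image, Finset.mem_coe]
    constructor
    · rintro ⟨v, rfl⟩
      by_cases hv : v ∈ U
      · exact Or.inr ⟨v, hv, rfl⟩
      · exact Or.inl (hUc v hv)
    · rintro (rfl | ⟨v, -, rfl⟩)
      exacts [⟨y, rfl⟩, ⟨v, rfl⟩]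
  rw [this, Nat.card_coe_set_eq, Set.ncard_insert_of_notMem, Set.InjOn.ncard_image,
    Set.ncard_coe_finset]
  · exact fun a _ b hb h => hU b hb a h
  · rintro ⟨u, hu, h⟩
    exact hy (hU u hu y h.symm ▸ hu)

/-- The quotient has `U.card + 1` vertices, so a connected simple graph on them is a tree exactly
when it has `U.card` edges. The map `φ` sends edges of `F` to pairs of quotient vertices. Absence of
loops means that `φ` lands in the edges of the underlying simple graph, and absence of parallel
edges means that `φ` is injective on `F`. -/
lemma map_restrict_isSpanningTree_iff {G : SimpleGraph V} {f : V → α} {U : Finset V} {y : V}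
    (hU : ∀ u ∈ U, ∀ v, f v = f u → v = u) (hy : y ∉ U) (hUc : ∀ v, v ∉ U → f v = f y)
    {F : Finset (Sym2 V)} (hF : (F : Set (Sym2 V)) ⊆ G.edgeSet) :
    (((Graph.ofSimpleGraph G).map f).restrict F).IsSpanningTree ((Graph.ofSimpleGraph G).map f) ↔
      F ∈ G.rootedForests U := by
  classical
  rw [mem_rootedForests, ← map_restrict_connected_iff hU hy hUc hF]
  set T := ((Graph.ofSimpleGraph G).map f).restrict F
  have hlk : ∀ {e a b}, T.IsLink e a b ↔ e ∈ F ∧ ∃ p q, e = s(p, q) ∧ f p = a ∧ f q = b :=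
    map_restrict_isLink hF
  have hmem : ∀ v, f v ∈ T.vertexSet := fun v => ⟨v, trivial, rfl⟩
  have hV : Nat.card T.vertexSet = U.card + 1 := card_map_vertexSet G hU hy hUc
  have : Finite T.vertexSet := Nat.finite_of_card_ne_zero (by omega)
  let φ : Sym2 V → Sym2 T.vertexSet := Sym2.map fun v => ⟨f v, hmem v⟩
  -- Only an inclusion in general: a loop of `T` has an image under `φ` but gives no adjacency.
  have hsub : T.toSimpleGraph.edgeSet ⊆ φ '' F := by
    intro e
    induction e with
    | h a b =>
      rintro ⟨hne, e, he⟩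
      rw [hlk] at he
      obtain ⟨he, p, q, rfl, hp, hq⟩ := he
      refine ⟨_, he, ?_⟩
      simp only [φ, Sym2.map_mk]
      congr 2
  have hfin : (φ '' (F : Set (Sym2 V))).Finite := F.finite_toSet.image φ
  have hle : (φ '' (F : Set (Sym2 V))).ncard ≤ F.card := by
    simpa using Set.ncard_image_le (f := φ) F.finite_toSet
  have hlink : ∀ {e a b} (ha : a ∈ T.vertexSet) (hb : b ∈ T.vertexSet), T.IsLink e a b →
      φ e = s(⟨a, ha⟩, ⟨b, hb⟩) := by
    intro e a b ha hb he
    rw [hlk] at he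
    obtain ⟨he, p, q, rfl, rfl, rfl⟩ := he
    rfl
  constructor
  · rintro ⟨-, hS, hTree⟩
    refine ⟨hF, ?_, hTree.connected⟩
    have h1 := (isTree_iff_connected_and_card.1 hTree).2
    have h2 : φ '' F ⊆ T.toSimpleGraph.edgeSet := by
      rintro _ ⟨e, he, rfl⟩
      induction e with
      | h p q =>
        have hl : T.IsLink s(p, q) (f p) (f q) := by
          rw [hlk]
          exact ⟨he, p, q, rfl, rfl, rfl⟩
        exact ⟨fun h => hl.ne (congrArg Subtype.val h), _, hl⟩
    have h3 : Set.InjOn φ F := by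
      intro e he e' he' h
      induction e with
      | h p q =>
      induction e' with
      | h p' q' =>
        have hl : T.IsLink s(p, q) (f p) (f q) := by
          rw [hlk]
          exact ⟨he, p, q, rfl, rfl, rfl⟩
        have hl' : T.IsLink s(p', q') (f p') (f q') := by
          rw [hlk]
          exact ⟨he', p', q', rfl, rfl, rfl⟩
        simp only [φ, Sym2.map_mk, Sym2.eq_iff, Subtype.mk.injEq] at h
        rcases h with ⟨h, h'⟩ | ⟨h, h'⟩
        · rw [← h, ← h'] at hl'
          exact hl.eq hl'
        · rw [← h, ← h'] at hl'
          exact hl.eq hl'.symm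
    have h4 : (φ '' (F : Set (Sym2 V))).ncard = F.card := by
      rw [h3.ncard_image, Set.ncard_coe_finset]
    rw [Nat.card_coe_set_eq, ← h2.antisymm hsub, h4] at h1
    omega
  · rintro ⟨-, hcard, hconn⟩
    -- Connectedness forces at least `U.card` adjacencies, while `F` supplies at most `U.card`.
    -- Every inequality in between is thus an equality, which excludes loops and parallel edges at
    -- once.
    have h1 := hconn.card_vert_le_card_edgeSet_add_one
    rw [Nat.card_coe_set_eq T.toSimpleGraph.edgeSet] at h1
    have h2 := Set.ncard_le_ncard hsub hfin
    have heq : T.toSimpleGraph.edgeSet = φ '' F :=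
      Set.eq_of_subset_of_ncard_le hsub (by omega) hfin
    have hinj : Set.InjOn φ F := by
      refine Set.injOn_of_ncard_image_eq ?_ F.finite_toSet
      rw [Set.ncard_coe_finset]
      omega
    refine ⟨⟨Graph.restrict_le, rfl⟩, ?_, ?_⟩
    · refine { not_isLoopAt := fun e a h => ?_, eq_of_isLink := fun e e' a b h h' => ?_ }
      · have he : φ e ∈ T.toSimpleGraph.edgeSet := by
          rw [heq]
          exact ⟨e, h.edge_mem.2, rfl⟩
        rw [hlink h.vertex_mem h.vertex_mem h, mem_edgeSet] at he
        exact he.ne rfl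
      · exact hinj h.edge_mem.2 h'.edge_mem.2
          ((hlink h.left_mem h.right_mem h).trans (hlink h.left_mem h.right_mem h').symm)
    · rw [isTree_iff_connected_and_card, Nat.card_coe_set_eq]
      exact ⟨hconn, by omega⟩

/-- Spanning trees of the multigraph obtained from `G` by identifying the vertices outside `U`
correspond to the forests rooted outside `U`. -/
theorem numSpanningTrees_map (G : SimpleGraph V) {f : V → α} {U : Finset V} {y : V}
    (hU : ∀ u ∈ U, ∀ v, f v = f u → v = u) (hy : y ∉ U) (hUc : ∀ v, v ∉ U → f v = f y) :
    ((Graph.ofSimpleGraph G).map f).numSpanningTrees = (G.rootedForests U).card := by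
  classical
  rw [Graph.numSpanningTrees, ← Set.ncard_coe_finset]
  symm
  refine Set.ncard_congr (fun F _ => ((Graph.ofSimpleGraph G).map f).restrict F) ?_ ?_ ?_
  · intro F hF
    exact (map_restrict_isSpanningTree_iff hU hy hUc (mem_rootedForests.1 hF).1).2 hF
  · intro F F' hF hF' h
    have h1 := congrArg Graph.edgeSet h
    simp only [Graph.edgeSet_restrict, Graph.edgeSet_map, Graph.edgeSet_ofSimpleGraph] at h1
    rw [Set.inter_eq_right.2 (mem_rootedForests.1 hF).1,
      Set.inter_eq_right.2 (mem_rootedForests.1 hF').1] at h1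
    exact Finset.coe_injective h1
  · intro T hT
    have hE : T.edgeSet ⊆ G.edgeSet := hT.1.le.edgeSet_mono
    have hF : ((T.edgeSet.toFinset : Finset (Sym2 V)) : Set (Sym2 V)) = T.edgeSet := by simp
    have hR : ((Graph.ofSimpleGraph G).map f).restrict T.edgeSet = T := by
      refine (Graph.Compatible.of_le_le Graph.restrict_le hT.1.le).ext ?_ ?_
      · exact hT.1.vertexSet_eq.symm
      · exact Set.inter_eq_right.2 hE
    refine ⟨T.edgeSet.toFinset, ?_, by rw [hF, hR]⟩
    rw [Finset.mem_coe, ← map_restrict_isSpanningTree_iff hU hy hUc (by rwa [hF]), hF, hR]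
    exact hT

theorem numSpanningTrees_ofSimpleGraph (G : SimpleGraph V) (y : V) :
    (Graph.ofSimpleGraph G).numSpanningTrees = (G.rootedForests (Finset.univ.erase y)).card := by
  rw [← numSpanningTrees_map G (f := id) (y := y) (fun _ _ _ h => h) (by simp) (by simp),
    Graph.map_id]

theorem numSpanningTrees_contract (G : SimpleGraph V) {S : Set V} {U : Finset V} {y : V}
    (hS : ∀ v, v ∈ S ↔ v ∉ U) (hy : y ∈ S) :
    ((Graph.ofSimpleGraph G).contract S).numSpanningTrees = (G.rootedForests U).card := by
  refine numSpanningTrees_map G (y := y) ?_ ((hS y).1 hy) ?_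
  · intro u hu v h
    have hu' : u ∉ S := fun h => (hS u).1 h hu
    by_cases hv : v ∈ S
    · simp [hv, hu'] at h
    · simpa [hv, hu'] using h
  · intro v hv
    simp [(hS v).2 hv, hy]

/-- A connected graph has a spanning tree. -/
lemma rootedForests_erase_nonempty {G : SimpleGraph V} (hG : G.Connected) (y : V) :
    (G.rootedForests (Finset.univ.erase y)).Nonempty := by
  classical
  obtain ⟨T, hle, hT⟩ := hG.exists_isTree_le
  refine ⟨T.edgeFinset, ?_⟩
  rw [mem_rootedForests, coe_edgeFinset, fromEdgeSet_edgeSet]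
  refine ⟨edgeSet_mono hle, ?_, fun v => ⟨y, by simp, hT.connected.preconnected v y⟩⟩
  have := hT.card_edgeFinset
  rw [Finset.card_erase_of_mem (Finset.mem_univ y), Finset.card_univ]
  omega

end SimpleGraph

/-! ### Hitting times as sums of avoidance probabilities -/

lemma ENat.toENNReal_eq_tsum {N : ℕ∞} {p : ℕ → Prop} [DecidablePred p]
    (h : ∀ n : ℕ, (n : ℕ∞) < N ↔ p n) : (N : ℝ≥0∞) = ∑' n : ℕ, if p n then 1 else 0 := by
  simp only [← h]
  induction N using ENat.recTopCoe with
  | top => simp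
  | coe N =>
    rw [tsum_eq_sum (s := Finset.range N)]
    · rw [Finset.sum_congr rfl (g := fun _ => 1)]
      · simp
      · intro n hn
        simpa using hn
    · intro n hn
      simpa using hn

namespace SimpleGraph
variable {V : Type*} [Fintype V] [DecidableEq V] (G : SimpleGraph V) [DecidableRel G.Adj]

/-- The transition operator of the simple random walk. -/
noncomputable def walkOp (g : V → ℝ≥0∞) (v : V) : ℝ≥0∞ := ∑ z, G.walkStep v z * g z

/-- The probability that the walk started at `x` avoids `y` up to time `n`. -/
noncomputable def avoidProb (y : V) : ℕ → V → ℝ≥0∞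
  | 0, x => if x = y then 0 else 1
  | n + 1, x => if x = y then 0 else G.walkOp (avoidProb y n) x

/-- The operator `g ↦ E_x[g(X_n); X_0, …, X_n ≠ y]`, by recursion at time `0`. -/
noncomputable def avoidOp (y : V) : ℕ → (V → ℝ≥0∞) → V → ℝ≥0∞
  | 0, g => fun x => if x = y then 0 else g x
  | n + 1, g => fun x => if x = y then 0 else G.walkOp (avoidOp y n g) x

/-- Passes from recursion at the first step, which yields the first-step equations, to recursion at
the last step, which is what the Markov property of the trajectory measure provides. -/
lemma avoidOp_succ (y : V) (n : ℕ) (g : V → ℝ≥0∞) :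
    G.avoidOp y (n + 1) g = G.avoidOp y n (G.walkOp fun z => if z = y then 0 else g z) := by
  induction n with
  | zero => rfl
  | succ n ih =>
    ext x
    rw [avoidOp, ih]
    rfl

lemma avoidOp_one (y : V) (n : ℕ) : G.avoidOp y n 1 = G.avoidProb y n := by
  induction n with
  | zero => rfl
  | succ n ih =>
    ext x
    rw [avoidOp, ih]
    rfl

section Measure
variable [MeasurableSpace V] [DiscreteMeasurableSpace V]

omit [DecidableEq V] in
lemma lintegral_walkKernel (g : V → ℝ≥0∞) (v : V) : ∫⁻ z, g z ∂G.walkKernel v = G.walkOp g v := by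
  change ∫⁻ z, g z ∂(G.walkStep v).toMeasure = _
  rw [lintegral_fintype, walkOp]
  refine Finset.sum_congr rfl fun z _ => ?_
  rw [PMF.toMeasure_apply_singleton _ _ (measurableSet_singleton z), mul_comm]

omit [DecidableEq V] in
lemma lintegral_walkLaw_zero (x : V) (g : V → ℝ≥0∞) : ∫⁻ ω, g (ω 0) ∂G.walkLaw x = g x := by
  have hg : Measurable g := Measurable.of_discrete
  rw [walkLaw]
  refine (Kernel.lintegral_traj (X := fun _ => V) _ (hg.comp (measurable_pi_apply 0))).trans ?_
  simp [Function.updateFinset]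

omit [DecidableEq V] in
/-- The Markov property at time `n`. -/
lemma lintegral_walkLaw_succ (x : V) (n : ℕ) (φ : ((i : Finset.Iic n) → V) → ℝ≥0∞)
    (hφ : Measurable φ) (g : V → ℝ≥0∞) :
    ∫⁻ ω, φ (Preorder.frestrictLe n ω) * g (ω (n + 1)) ∂G.walkLaw x =
      ∫⁻ ω, φ (Preorder.frestrictLe n ω) * G.walkOp g (ω n) ∂G.walkLaw x := by
  have hg : Measurable g := Measurable.of_discrete
  have hg' : Measurable (G.walkOp g) := Measurable.of_discrete
  set κ : (n : ℕ) → Kernel ((i : Finset.Iic n) → V) V :=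
    fun n => G.walkKernel.comap (fun h : (i : Finset.Iic n) → V => h ⟨n, Finset.mem_Iic.2 le_rfl⟩)
      (measurable_pi_apply _)
  have hlaw : G.walkLaw x = Kernel.traj (X := fun _ => V) κ 0 (fun _ => x) := rfl
  have h1 := Kernel.partialTraj_compProd_eq_map_traj (X := fun _ => V) (κ := κ) (a := 0) (b := n)
    (Nat.zero_le n) (x₀ := fun _ => x)
  have hm : Measurable fun p : ((i : Finset.Iic n) → V) × V => φ p.1 * g p.2 := by fun_prop
  have h2 : ∫⁻ ω, φ (Preorder.frestrictLe n ω) * g (ω (n + 1)) ∂G.walkLaw x =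
      ∫⁻ p, φ p.1 * g p.2 ∂((G.walkLaw x).map fun ω => (Preorder.frestrictLe n ω, ω (n + 1))) := by
    rw [lintegral_map hm (by fun_prop)]
  rw [h2, hlaw, ← h1, Measure.lintegral_compProd hm]
  rw [← Kernel.traj_map_frestrictLe_apply, lintegral_map]
  · refine lintegral_congr fun ω => ?_
    refine (lintegral_const_mul (μ := κ n (Preorder.frestrictLe n ω))
      (φ (Preorder.frestrictLe n ω)) hg).trans ?_
    congr 1
    exact G.lintegral_walkKernel g (ω n)
  · exact Measurable.lintegral_kernel_prod_right' hm
  · fun_prop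

lemma lintegral_avoid (x y : V) (n : ℕ) : ∀ g : V → ℝ≥0∞,
    ∫⁻ ω, (if ∀ k ≤ n, ω k ≠ y then 1 else 0) * g (ω n) ∂G.walkLaw x = G.avoidOp y n g x := by
  classical
  induction n with
  | zero =>
    intro g
    have := G.lintegral_walkLaw_zero x fun z => if z = y then 0 else g z
    refine Eq.trans ?_ this
    refine lintegral_congr fun ω => ?_
    by_cases h : ω 0 = y <;> simp [h]
  | succ n ih =>
    intro g
    rw [avoidOp_succ, ← ih]
    have hφ : Measurable fun h : (i : Finset.Iic n) → V =>
        if ∀ k : Finset.Iic n, h k ≠ y then (1 : ℝ≥0∞) else 0 := Measurable.of_discrete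
    have h1 := G.lintegral_walkLaw_succ x n _ hφ fun z => if z = y then 0 else g z
    have h2 : ∀ ω : ℕ → V, (∀ k : Finset.Iic n, Preorder.frestrictLe n ω k ≠ y) ↔
        ∀ k ≤ n, ω k ≠ y := by
      intro ω
      simp [Preorder.frestrictLe_apply]
    simp only [h2] at h1
    rw [← h1]
    refine lintegral_congr fun ω => ?_
    have h3 : (∀ k ≤ n + 1, ω k ≠ y) ↔ (∀ k ≤ n, ω k ≠ y) ∧ ω (n + 1) ≠ y := by
      constructor
      · exact fun h => ⟨fun k hk => h k (by omega), h _ le_rfl⟩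
      · rintro ⟨h, h'⟩ k hk
        rcases Nat.lt_or_ge n k with h | h
        · rwa [show k = n + 1 by omega]
        · exact ‹∀ k ≤ n, ω k ≠ y› k h
    by_cases ha : ∀ k ≤ n, ω k ≠ y <;> by_cases hb : ω (n + 1) = y <;> simp [h3, ha, hb]

end Measure

/-- Tail-sum formula: the hitting time exceeds `n` exactly when the walk avoids `y` at all times up
to and including `n`. -/
lemma expectedHittingTime_eq_tsum (x y : V) :
    G.expectedHittingTime x y = ∑' n, G.avoidProb y n x := by
  let _ : MeasurableSpace V := ⊤
  have _ : DiscreteMeasurableSpace V := ⟨fun _ => trivial⟩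
  have h1 : G.expectedHittingTime x y =
      ∫⁻ ω : ℕ → V, ENat.toENNReal (hittingAfter (fun n (ω : ℕ → V) => ω n) {y} 0 ω)
        ∂(G.walkLaw x) := rfl
  have h2 : ∀ (n : ℕ) (ω : ℕ → V),
      (n : ℕ∞) < hittingAfter (fun n (ω : ℕ → V) => ω n) {y} 0 ω ↔ ∀ k ≤ n, ω k ≠ y := by
    intro n ω
    have := hittingAfter_le_iff (u := fun n (ω : ℕ → V) => ω n) (s := {y}) (n := 0) (ω := ω)
      (i := n)
    refine (not_le (α := ℕ∞)).symm.trans ((not_congr this).trans ?_)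
    simp
  have h3 : ∀ n, Measurable fun ω : ℕ → V => if ∀ k ≤ n, ω k ≠ y then (1 : ℝ≥0∞) else 0 := by
    intro n
    refine Measurable.ite ?_ measurable_const measurable_const
    simp only [Set.ofPred_forall]
    refine MeasurableSet.iInter fun k => MeasurableSet.iInter fun _ => ?_
    exact measurableSet_eq_fun (measurable_pi_apply k) measurable_const |>.compl
  have h4 : ∀ ω : ℕ → V, ENat.toENNReal (hittingAfter (fun n (ω : ℕ → V) => ω n) {y} 0 ω) =
      ∑' n : ℕ, if ∀ k ≤ n, ω k ≠ y then 1 else 0 := fun ω =>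
    ENat.toENNReal_eq_tsum fun n => h2 n ω
  rw [h1, lintegral_congr h4, lintegral_tsum fun n => (h3 n).aemeasurable]
  refine tsum_congr fun n => ?_
  rw [← avoidOp_one, ← lintegral_avoid]
  simp

/-! ### The first-step equations as a linear system -/

lemma expectedHittingTime_self (y : V) : G.expectedHittingTime y y = 0 := by
  rw [expectedHittingTime_eq_tsum, ENNReal.tsum_eq_zero]
  rintro (_ | n) <;> simp [avoidProb]

lemma expectedHittingTime_of_ne {x y : V} (h : x ≠ y) :
    G.expectedHittingTime x y = 1 + G.walkOp (fun z => G.expectedHittingTime z y) x := by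
  simp only [expectedHittingTime_eq_tsum]
  rw [tsum_eq_zero_add' ENNReal.summable]
  simp only [avoidProb, if_neg h, walkOp, ← ENNReal.tsum_mul_left]
  rw [Summable.tsum_finsetSum fun _ _ => ENNReal.summable]

/-- The expected hitting time is at most every supersolution of the first step equations. -/
lemma expectedHittingTime_le {y : V} {g : V → ℝ≥0∞} (hg : ∀ x, x ≠ y → 1 + G.walkOp g x ≤ g x)
    (x : V) : G.expectedHittingTime x y ≤ g x := by
  rw [expectedHittingTime_eq_tsum]
  refine ENNReal.tsum_le_of_sum_range_le fun n => ?_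
  induction n generalizing x with
  | zero => simp
  | succ n ih =>
    -- Splitting off time `0` leaves the walk operator applied to a shorter partial sum, which the
    -- induction hypothesis bounds.
    rw [Finset.sum_range_succ']
    by_cases h : x = y
    · simp [avoidProb, h]
    · refine le_trans ?_ (hg x h)
      rw [add_comm]
      simp only [avoidProb, if_neg h, walkOp]
      rw [Finset.sum_comm]
      simp only [← Finset.mul_sum]
      gcongr
      exact ih _

omit [DecidableEq V] in
lemma walkOp_of_degree_pos {v : V} (hv : 0 < G.degree v) (g : V → ℝ≥0∞) :
    G.walkOp g v = (G.degree v : ℝ≥0∞)⁻¹ * ∑ z ∈ G.neighborFinset v, g z := by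
  have h : (G.neighborFinset v).Nonempty := by
    rwa [← Finset.card_pos, card_neighborFinset_eq_degree]
  rw [walkOp, Finset.mul_sum, ← Finset.sum_subset (Finset.subset_univ (G.neighborFinset v))]
  · refine Finset.sum_congr rfl fun z hz => ?_
    rw [walkStep, dif_pos h, PMF.uniformOfFinset_apply_of_mem _ hz, card_neighborFinset_eq_degree]
  · intro z _ hz
    rw [walkStep, dif_pos h, PMF.uniformOfFinset_apply_of_notMem _ hz, zero_mul]

omit [DecidableEq V] in
lemma walkOp_ofReal {v : V} (hv : 0 < G.degree v) {g : V → ℝ} (hg : ∀ z, 0 ≤ g z) :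
    G.walkOp (fun z => ENNReal.ofReal (g z)) v =
      ENNReal.ofReal ((G.degree v : ℝ)⁻¹ * ∑ z ∈ G.neighborFinset v, g z) := by
  rw [walkOp_of_degree_pos G hv, ENNReal.ofReal_mul (by positivity),
    ENNReal.ofReal_sum_of_nonneg fun z _ => hg z, ENNReal.ofReal_inv_of_pos (by positivity),
    ENNReal.ofReal_natCast]

/-- The linear system satisfied by the hitting times of `y`. -/
lemma auxMatrix_mulVec_eq_iff (y : V) (g : V → ℝ) :
    (G.auxMatrix (fun v => (G.degree v : ℝ)) (Finset.univ.erase y)).mulVec g =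
        (fun v => if v = y then 0 else (G.degree v : ℝ)) ↔
      g y = 0 ∧ ∀ v, v ≠ y → G.degree v * g v = G.degree v + ∑ z ∈ G.neighborFinset v, g z := by
  -- Row `y` of the matrix is a unit vector and encodes the boundary condition `g y = 0`. That
  -- condition in turn makes the missing column `y` harmless in the other rows.
  have hy : (G.auxMatrix (fun v => (G.degree v : ℝ)) (Finset.univ.erase y)).mulVec g y = g y := by
    rw [Matrix.mulVec, dotProduct, Finset.sum_eq_single y] <;> simp +contextual [auxMatrix, eq_comm]
  have hv : g y = 0 → ∀ v, v ≠ y →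
      (G.auxMatrix (fun v => (G.degree v : ℝ)) (Finset.univ.erase y)).mulVec g v =
        G.degree v * g v - ∑ z ∈ G.neighborFinset v, g z := by
    intro h0 v hvy
    have hmem : v ∈ Finset.univ.erase y := by simp [hvy]
    rw [Matrix.mulVec, dotProduct, ← Finset.add_sum_erase _ _ (Finset.mem_univ v),
      auxMatrix_diag _ _ _ hmem, sub_eq_add_neg, ← Finset.sum_neg_distrib]
    congr 1
    rw [neighborFinset_eq_filter, Finset.sum_filter, ← Finset.add_sum_erase _ _ (Finset.mem_univ v)]
    simp only [SimpleGraph.irrefl, if_false, zero_add]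
    refine Finset.sum_congr rfl fun z hz => ?_
    rw [auxMatrix_of_mem _ _ _ hmem (Finset.ne_of_mem_erase hz).symm]
    by_cases hzy : z = y
    · subst hzy; simp [h0]
    · by_cases hA : G.Adj v z <;> simp [hzy, hA]
  constructor
  · intro h
    have h0 : g y = 0 := by rw [← hy, h]; simp
    refine ⟨h0, fun v hvy => ?_⟩
    have := hv h0 v hvy
    rw [h] at this
    simp only [hvy, if_false] at this
    linarith
  · rintro ⟨h0, h⟩
    ext v
    by_cases hvy : v = y
    · subst hvy; simp [hy, h0]
    · rw [hv h0 v hvy, h v hvy]; simp [hvy]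

end SimpleGraph

/-! ### Solving the system by the adjugate, and the theorem -/

namespace SimpleGraph
variable {V : Type*} [Fintype V] [DecidableEq V] (G : SimpleGraph V) [DecidableRel G.Adj]

lemma invR_degree (U : Finset V) :
    G.invR (fun v => (G.degree v : ℝ)) U = ((G.rootedForests U).card : ℝ) := by
  rw [invR_eq_det _ _ _ _ rfl, det_auxMatrix_degree _ G U rfl]

lemma adjugate_auxMatrix_nonneg {U : Finset V} {x u : V} (hx : x ∈ U) (hu : u ∈ U) :
    0 ≤ (G.auxMatrix (fun v => (G.degree v : ℝ)) U).adjugate x u := by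
  rw [adjugate_auxMatrix _ _ _ _ U rfl x hx hu]
  refine Finset.sum_nonneg fun P _ => ?_
  rw [det_auxMatrix_degree _ G _ rfl]
  positivity

/-- The hitting times of `y` are finite and are computed by the adjugate of the Laplacian with the
row and the column of `y` removed. -/
lemma expectedHittingTime_eq_ofReal (hG : G.Connected) {x y : V} (hxy : x ≠ y) :
    0 ≤ (((G.rootedForests (Finset.univ.erase y)).card : ℝ)⁻¹ •
        (G.auxMatrix (fun v => (G.degree v : ℝ)) (Finset.univ.erase y)).adjugate.mulVec
          (fun v => if v = y then 0 else (G.degree v : ℝ))) x ∧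
    G.expectedHittingTime x y =
      ENNReal.ofReal ((((G.rootedForests (Finset.univ.erase y)).card : ℝ)⁻¹ •
        (G.auxMatrix (fun v => (G.degree v : ℝ)) (Finset.univ.erase y)).adjugate.mulVec
          (fun v => if v = y then 0 else (G.degree v : ℝ))) x) := by
  have : Nontrivial V := ⟨x, y, hxy⟩
  set c : ℝ := ((G.rootedForests (Finset.univ.erase y)).card : ℝ) with hc
  set M := G.auxMatrix (fun v => (G.degree v : ℝ)) (Finset.univ.erase y) with hM
  set b : V → ℝ := fun v => if v = y then 0 else (G.degree v : ℝ) with hb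
  set g : V → ℝ := c⁻¹ • M.adjugate.mulVec b with hg
  have hdeg : ∀ v, 0 < G.degree v := fun v => hG.preconnected.degree_pos_of_nontrivial v
  have hcpos : 0 < c := Nat.cast_pos.2 (Finset.card_pos.2 (rootedForests_erase_nonempty hG y))
  have hdet : M.det = c := det_auxMatrix_degree _ G _ rfl
  have hMg : M.mulVec g = b := by
    rw [hg, Matrix.mulVec_smul, Matrix.mulVec_mulVec, Matrix.mul_adjugate, hdet,
      Matrix.smul_mulVec, Matrix.one_mulVec, smul_smul, inv_mul_cancel₀ hcpos.ne', one_smul]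
  have huniq : ∀ g' : V → ℝ, M.mulVec g' = b → g' = g := by
    intro g' h
    rw [hg, ← h, Matrix.mulVec_mulVec, Matrix.adjugate_mul, hdet,
      Matrix.smul_mulVec, Matrix.one_mulVec, smul_smul, inv_mul_cancel₀ hcpos.ne', one_smul]
  obtain ⟨hgy, hgv⟩ := (G.auxMatrix_mulVec_eq_iff y g).1 hMg
  have hg0 : ∀ v, 0 ≤ g v := by
    intro v
    by_cases hv : v = y
    · rw [hv, hgy]
    · rw [hg, Pi.smul_apply, smul_eq_mul]
      refine mul_nonneg (by positivity) (Finset.sum_nonneg fun u _ => ?_)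
      by_cases hu : u = y
      · simp [hb, hu]
      · refine mul_nonneg (G.adjugate_auxMatrix_nonneg (by simp [hv]) (by simp [hu])) ?_
        simp only [hb, hu, if_false]
        positivity
  -- A nonnegative real solution is in particular a supersolution, and this yields finiteness.
  have hle : ∀ v, G.expectedHittingTime v y ≤ ENNReal.ofReal (g v) := by
    refine G.expectedHittingTime_le (g := fun v => ENNReal.ofReal (g v)) fun v hv => ?_
    have hd : (0 : ℝ) < G.degree v := Nat.cast_pos.2 (hdeg v)
    rw [walkOp_ofReal G (hdeg v) hg0, ← ENNReal.ofReal_one,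
      ← ENNReal.ofReal_add zero_le_one
        (mul_nonneg (by positivity) (Finset.sum_nonneg fun z _ => hg0 z))]
    refine ENNReal.ofReal_le_ofReal (le_of_eq ?_)
    have := hgv v hv
    field_simp
    linarith
  have hfin : ∀ v, G.expectedHittingTime v y ≠ ∞ :=
    fun v => ne_top_of_le_ne_top ENNReal.ofReal_ne_top (hle v)
  -- Once finite, the hitting times solve the same real system, whose solution is unique because
  -- `M.det` is nonzero.
  have hh : (fun v => (G.expectedHittingTime v y).toReal) = g := by
    refine huniq _ ((G.auxMatrix_mulVec_eq_iff y _).2 ⟨?_, fun v hv => ?_⟩)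
    · simp [expectedHittingTime_self]
    · have hd : (0 : ℝ) < G.degree v := Nat.cast_pos.2 (hdeg v)
      have h1 := G.walkOp_ofReal (hdeg v)
        (g := fun z => (G.expectedHittingTime z y).toReal) fun z => ENNReal.toReal_nonneg
      simp only [ENNReal.ofReal_toReal (hfin _)] at h1
      have hnn : 0 ≤ (G.degree v : ℝ)⁻¹ *
          ∑ z ∈ G.neighborFinset v, (G.expectedHittingTime z y).toReal :=
        mul_nonneg (by positivity) (Finset.sum_nonneg fun z _ => ENNReal.toReal_nonneg)
      rw [expectedHittingTime_of_ne G hv, h1, ENNReal.toReal_add ENNReal.one_ne_top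
        ENNReal.ofReal_ne_top, ENNReal.toReal_ofReal hnn, ENNReal.toReal_one]
      field_simp
  exact ⟨hg0 x, by rw [← hh, ENNReal.ofReal_toReal (hfin x)]⟩

end SimpleGraph

theorem theorem2p7 {V : Type*} [Fintype V] [DecidableEq V] (G : SimpleGraph V)
    [DecidableRel G.Adj] (hG : G.Connected) (x y : V) :
    (G.expectedHittingTime x y ≠ ∞ ∧
      (G.expectedHittingTime x y).toReal =
        1 / ((Graph.ofSimpleGraph G).numSpanningTrees : ℝ) *
          ∑ u : V, (G.degree u : ℝ) *
            ∑ P : G.Path x u with y ∉ P.1.support,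
              G.invR (fun v => (G.degree v : ℝ))
                (Finset.univ \ insert y P.1.support.toFinset)) ∧
    ∀ (u : V) (P : G.Path x u), y ∉ P.1.support →
      G.invR (fun v => (G.degree v : ℝ)) (Finset.univ \ insert y P.1.support.toFinset) =
        (((Graph.ofSimpleGraph G).contract
          (insert y {v | v ∈ P.1.support})).numSpanningTrees : ℝ) := by
  refine ⟨?_, fun u P _ => ?_⟩
  · by_cases hxy : x = y
    · subst hxy
      rw [G.expectedHittingTime_self]
      simp
    · obtain ⟨h0, h⟩ := G.expectedHittingTime_eq_ofReal hG hxy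
      refine ⟨h ▸ ENNReal.ofReal_ne_top, ?_⟩
      rw [h, ENNReal.toReal_ofReal h0, SimpleGraph.numSpanningTrees_ofSimpleGraph G y,
        Pi.smul_apply, smul_eq_mul, one_div]
      congr 1
      refine Finset.sum_congr rfl fun u _ => ?_
      rw [mul_comm]
      beta_reduce
      -- At `u = y` both sides vanish: the right-hand vector of the system is `0` there, and no path
      -- ending at `y` avoids `y`.
      by_cases hu : u = y
      · subst hu
        rw [if_pos rfl, zero_mul, Finset.filter_false_of_mem, Finset.sum_empty, mul_zero]
        exact fun P _ h => h P.1.end_mem_support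
      · rw [if_neg hu, SimpleGraph.adjugate_auxMatrix _ _ _ _ _ rfl x (by simp [hxy]) (by simp [hu])]
        congr 1
        refine Finset.sum_congr (Finset.filter_congr fun P _ => ?_) fun P _ => ?_
        · simp [Finset.subset_erase]
        · rw [SimpleGraph.invR_eq_det _ _ _ _ rfl, Finset.erase_sdiff_comm, Finset.sdiff_insert]
  · rw [SimpleGraph.invR_degree, SimpleGraph.numSpanningTrees_contract G (y := y) ?_ (by simp)]
    intro v
    simp [or_iff_not_imp_left]
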